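/- Let $V$ be a finite set, let $k,d,\Delta\ge 0$ be integers, and let $G_1,\dots,G_k$ be graphs with common vertex set $V$; the graphs have no loops, but parallel edges are allowed, and the degree of a vertex is the number of edges incident with it. Suppose that each $G_i$ is $d$-degenerate (that is, every subgraph of $G_i$ with at least one vertex has a vertex whose degree in that subgraph is at most $d$) and has maximum degree at most $\Delta$. If $$k \ge 13\bigl(1+d\log(d\Delta)\bigr),$$ where $\log$ is the natural logarithm and $d\log(d\Delta)$ is read as $0$ when $d\Delta=0$, then the family $G_1,\dots,G_k$ has a cooperative coloring, that is, there are sets $R_1,\dots,R_k\subseteq V$ such that $R_i$ is an independent set of $G_i$ (no edge of $G_i$ joins two vertices of $R_i$) for each $1\le i\le k$, and $V=\bigcup_{i=1}^k R_i$. -/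

import Mathlib

open scoped Graph

namespace CoopColoring

/-- The degree of the vertex `v` in the loopless multigraph `G`: the number of edges incident
with `v`, parallel edges being counted separately. -/
noncomputable def degree {α β : Type*} (G : Graph α β) (v : α) : ℕ∞ :=
  (G.incidenceSet v).encard

/-- The maximum degree of a loopless multigraph (`0` if there are no vertices). -/
noncomputable def maxDegree {α β : Type*} (G : Graph α β) : ℕ∞ :=
  ⨆ v ∈ V(G), degree G v

/-- A (finite, loopless) multigraph is `d`-degenerate if each of its subgraphs with at least one
vertex has a vertex of degree at most `d` in that subgraph. -/
def IsDegenerate {α β : Type*} (G : Graph α β) (d : ℕ) : Prop :=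
  ∀ H : Graph α β, H ≤ G → V(H).Nonempty → ∃ v ∈ V(H), degree H v ≤ d

/-- `S` is an independent set of `G`: a set of vertices that contains no two adjacent vertices. -/
def IsIndependentSet {α β : Type*} (G : Graph α β) (S : Set α) : Prop :=
  S ⊆ V(G) ∧ ∀ x ∈ S, ∀ y ∈ S, ¬ G.Adj x y

/-- `R 0, …, R (k - 1)` is a cooperative coloring of the family `G 0, …, G (k - 1)` of graphs on
the common vertex set `V`: each `R i` is an independent set of `G i`, and together the sets `R i`
cover `V`. -/
def IsCooperativeColoring {α β : Type*} {k : ℕ} (V : Set α) (G : Fin k → Graph α β)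
    (R : Fin k → Set α) : Prop :=
  (∀ i, IsIndependentSet (G i) (R i)) ∧ V = ⋃ i, R i

end CoopColoring

/-!
Orient each graph `G i` with out-degrees at most `D = min d Δ`; degeneracy provides such an
orientation (`exists_orientation`). Every vertex `v` receives a random list of colours that contains
each colour independently with probability `1 / (D + 1)`. If for every `v` some colour `i` lies in
the list of `v` and in the list of no out-neighbour of `v` in `G i`, then giving each vertex such a
colour is a cooperative colouring: if `v → u` is an arc of `G i` and `v` has colour `i`, then `i` is
not even in the list of `u`. The orientations of different graphs need not be related in any way.

A fixed colour is good for `v` with probability at least `(1 / (D + 1)) (D / (D + 1)) ^ D`, and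
different colours are independent, so `v` has no good colour with probability at most `q ^ k`, where
`q = 1 - (1 / (D + 1)) (D / (D + 1)) ^ D` (`card_blockedEvent_le`). This event depends only on the
presence of a colour `i` in the lists of `v` and of its out-neighbours in `G i`, hence it is
independent of the corresponding events of all but `k (Δ + D (Δ - 1))` other vertices
(`card_dependencySet_le`). The symmetric Lovász local lemma (`exists_forall_notMem_of_local`) then
applies by the numerical estimate `pow_le_local_bound`, which has little room for `D = Δ = 1`.

Probabilities are quotients of cardinalities: the outcomes are the functions
`f : I → V → Fin (D + 1)`, and colour `i` is in the list of `v` when `f i v = 0`.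
-/

open Finset

/-! ### The Lovász local lemma for counting -/

/-- The outcomes that avoid all the events `A w` with `w ∈ S`. -/
def avoiding {Ω ι : Type*} [Fintype Ω] [DecidableEq Ω] (A : ι → Finset Ω) (S : Finset ι) :
    Finset Ω :=
  {ω | ∀ w ∈ S, ω ∉ A w}

lemma card_avoiding_insert {Ω ι : Type*} [Fintype Ω] [DecidableEq Ω] [DecidableEq ι]
    (A : ι → Finset Ω) (S : Finset ι) (w : ι) :
    (#(avoiding A (insert w S)) : ℝ) = #(avoiding A S) - #(A w ∩ avoiding A S) := by
  have h1 : avoiding A (insert w S) = avoiding A S \ A w := by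
    ext ω; simp [avoiding, and_comm]
  have h2 := card_sdiff_add_card_inter (avoiding A S) (A w)
  rw [h1, inter_comm, ← h2]
  push_cast
  ring

/-- Conditional form of the symmetric Lovász local lemma, for the uniform measure on a finite type.
If `A v` has probability at most `x (1 - x) ^ N` given that any set of events outside the at most `N`
neighbours `Γ v` is avoided, then it has probability at most `x` given that an arbitrary set of other
events is avoided. -/
lemma card_inter_avoiding_le {Ω ι : Type*} [Fintype Ω] [DecidableEq Ω] [DecidableEq ι]
    (A : ι → Finset Ω) (Γ : ι → Finset ι) (N : ℕ) (x : ℝ) (hx0 : 0 ≤ x) (hx1 : x < 1)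
    (hΓ : ∀ v, #(Γ v) ≤ N)
    (h : ∀ v S, v ∉ S → Disjoint S (Γ v) →
      (#(A v ∩ avoiding A S) : ℝ) ≤ x * (1 - x) ^ N * #(avoiding A S))
    (S : Finset ι) (v : ι) (hv : v ∉ S) :
    (#(A v ∩ avoiding A S) : ℝ) ≤ x * #(avoiding A S) := by
  induction hn : #S using Nat.strong_induction_on generalizing S v with
  | _ n ih =>
  subst hn
  have hx : 0 ≤ 1 - x := by linarith
  -- Adding the neighbouring events one at a time loses a factor `1 - x` each.
  have key : ∀ T ⊆ S ∩ Γ v,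
      (1 - x) ^ #T * (#(avoiding A (S \ Γ v)) : ℝ) ≤ #(avoiding A (S \ Γ v ∪ T)) := by
    intro T
    induction T using Finset.induction_on with
    | empty => simp
    | insert w T hw ihT =>
      intro hT
      have hwS : w ∈ S ∩ Γ v := hT (mem_insert_self _ _)
      have hTS : T ⊆ S ∩ Γ v := (subset_insert _ _).trans hT
      have hwU : w ∉ S \ Γ v ∪ T := by
        simp only [mem_union, mem_sdiff, not_or, not_and, not_not]
        exact ⟨fun _ ↦ (mem_inter.1 hwS).2, hw⟩
      have hss : S \ Γ v ∪ T ⊂ S := by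
        refine ⟨union_subset sdiff_subset (hTS.trans inter_subset_left), fun hc ↦ ?_⟩
        exact hwU (hc (mem_inter.1 hwS).1)
      have h1 := ih _ (card_lt_card hss) _ w hwU rfl
      have h2 := ihT hTS
      rw [union_insert, card_avoiding_insert, card_insert_of_notMem hw, pow_succ]
      nlinarith
  have hunion : S \ Γ v ∪ S ∩ Γ v = S := sdiff_union_inter S (Γ v)
  have h1 := key _ subset_rfl
  rw [hunion] at h1
  have h2 := h v (S \ Γ v) (fun hc ↦ hv (mem_sdiff.1 hc).1) sdiff_disjoint
  have h3 : (#(A v ∩ avoiding A S) : ℝ) ≤ #(A v ∩ avoiding A (S \ Γ v)) := by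
    refine mod_cast card_le_card (inter_subset_inter_left fun ω hω ↦ ?_)
    simp only [avoiding, mem_filter, mem_univ, true_and, mem_sdiff] at hω ⊢
    exact fun w hw ↦ hω w hw.1
  have h4 : (1 - x) ^ N ≤ (1 - x) ^ #(S ∩ Γ v) :=
    pow_le_pow_of_le_one hx (by linarith) ((card_le_card inter_subset_right).trans (hΓ v))
  calc (#(A v ∩ avoiding A S) : ℝ) ≤ x * ((1 - x) ^ N * #(avoiding A (S \ Γ v))) := by
        rw [← mul_assoc]; exact h3.trans h2
    _ ≤ x * ((1 - x) ^ #(S ∩ Γ v) * #(avoiding A (S \ Γ v))) := by gcongr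
    _ ≤ x * #(avoiding A S) := by gcongr

/-- Symmetric Lovász local lemma for the uniform measure on a finite type: some outcome avoids all
the events. -/
theorem exists_forall_notMem_of_local {Ω ι : Type*} [Fintype Ω] [DecidableEq Ω] [Nonempty Ω]
    [Fintype ι] [DecidableEq ι]
    (A : ι → Finset Ω) (Γ : ι → Finset ι) (N : ℕ) (x : ℝ) (hx0 : 0 ≤ x) (hx1 : x < 1)
    (hΓ : ∀ v, #(Γ v) ≤ N)
    (h : ∀ v S, v ∉ S → Disjoint S (Γ v) →
      (#(A v ∩ avoiding A S) : ℝ) ≤ x * (1 - x) ^ N * #(avoiding A S)) :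
    ∃ ω, ∀ v, ω ∉ A v := by
  have hpos : ∀ S : Finset ι, (0 : ℝ) < #(avoiding A S) := by
    intro S
    induction S using Finset.induction_on with
    | empty => simp [avoiding, Fintype.card_pos]
    | insert w S hw ih =>
      have := card_inter_avoiding_le A Γ N x hx0 hx1 hΓ h S w hw
      rw [card_avoiding_insert]
      nlinarith
  obtain ⟨ω, hω⟩ := card_pos.1 (Nat.cast_pos.1 (hpos univ))
  simp only [avoiding, mem_filter, mem_univ, true_and, forall_const] at hω
  exact ⟨ω, hω⟩

/-- Events that depend on disjoint sets of coordinates are not positively correlated: exchanging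
the coordinates in `D` between two outcomes embeds `(E₁ ∩ E₂) × Ω` into `E₁ × E₂`. -/
lemma card_inter_mul_card_le {I V F : Type*} [Fintype I] [Fintype V] [Fintype F]
    [DecidableEq I] [DecidableEq V] [DecidableEq F]
    (D : I → V → Prop) (E₁ E₂ : Finset (I → V → F))
    (h₁ : ∀ f g : I → V → F, (∀ i v, D i v → f i v = g i v) → f ∈ E₁ → g ∈ E₁)
    (h₂ : ∀ f g : I → V → F, (∀ i v, ¬ D i v → f i v = g i v) → f ∈ E₂ → g ∈ E₂) :
    #(E₁ ∩ E₂) * Fintype.card (I → V → F) ≤ #E₁ * #E₂ := by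
  classical
  let mix : (I → V → F) → (I → V → F) → I → V → F :=
    fun f g i v ↦ if D i v then f i v else g i v
  rw [← card_univ, ← card_product, ← card_product]
  refine card_le_card_of_injOn (fun p ↦ (mix p.1 p.2, mix p.2 p.1)) ?_ ?_
  · rintro ⟨f, g⟩ hfg
    simp only [coe_product, Set.mem_prod, mem_coe, mem_inter, mem_univ, and_true] at hfg ⊢
    exact ⟨h₁ f _ (fun i v hD ↦ by simp [mix, hD]) hfg.1,
      h₂ f _ (fun i v hD ↦ by simp [mix, hD]) hfg.2⟩
  · rintro ⟨f, g⟩ - ⟨f', g'⟩ - heq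
    simp only [Prod.mk.injEq, funext_iff, mix] at heq ⊢
    refine ⟨fun i v ↦ ?_, fun i v ↦ ?_⟩ <;>
    · have ha := heq.1 i v
      have hb := heq.2 i v
      by_cases hD : D i v <;> simp_all

/-! ### Random lists of colours -/

/-- The event that a given colour is in the list of `v` and in the list of no out-neighbour `u ∈ N`
of `v`. Here `f u = 0` means that the colour is in the list of `u`; this has probability
`1 / (d + 1)`. -/
def availableEvent {V : Type*} [Fintype V] [DecidableEq V] (d : ℕ) (N : Finset V) (v : V) :
    Finset (V → Fin (d + 1)) :=
  {f | f v = 0 ∧ ∀ u ∈ N, f u ≠ 0}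

lemma card_availableEvent {V : Type*} [Fintype V] [DecidableEq V] (d : ℕ) (N : Finset V) (v : V)
    (hv : v ∉ N) :
    (#(availableEvent d N v) : ℝ) =
      1 / ((d : ℝ) + 1) * ((d : ℝ) / (d + 1)) ^ #N * Fintype.card (V → Fin (d + 1)) := by
  have hpi : availableEvent d N v =
      Fintype.piFinset fun u ↦ if u = v then {0} else if u ∈ N then {0}ᶜ else univ := by
    ext f
    simp only [availableEvent, mem_filter, mem_univ, true_and, Fintype.mem_piFinset]
    constructor
    · rintro ⟨h0, h⟩ u
      split_ifs with h1 h2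
      · simp [h1, h0]
      · simpa using h u h2
      · simp
    · intro h
      refine ⟨by simpa using h v, fun u hu ↦ ?_⟩
      have huv : u ≠ v := fun e ↦ hv (e ▸ hu)
      simpa [huv, hu] using h u
  have hterm : ∀ u : V, ((#(if u = v then ({0} : Finset (Fin (d + 1)))
      else if u ∈ N then {0}ᶜ else univ) : ℕ) : ℝ) =
      ((d : ℝ) + 1) * ((if u = v then 1 / ((d : ℝ) + 1) else 1) *
        (if u ∈ N then (d : ℝ) / (d + 1) else 1)) := by
    intro u
    by_cases h1 : u = v
    · subst h1; simp [hv]; field_simp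
    · by_cases h2 : u ∈ N <;> simp [h1, h2, card_compl]; field_simp
  rw [hpi, Fintype.card_piFinset, Nat.cast_prod, prod_congr rfl fun u _ ↦ hterm u,
    prod_mul_distrib, prod_mul_distrib, prod_ite_eq', prod_ite_mem, prod_const, prod_const]
  simp [card_univ]
  ring

/-- The event that every colour in the list of `v` is also in the list of one of the corresponding
out-neighbours of `v`. -/
def blockedEvent {I V : Type*} [Fintype I] [DecidableEq I] [Fintype V] [DecidableEq V] (d : ℕ)
    (N : I → V → Finset V) (v : V) : Finset (I → V → Fin (d + 1)) :=
  Fintype.piFinset fun i ↦ (availableEvent d (N i v) v)ᶜ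

lemma card_blockedEvent_le {I V : Type*} [Fintype I] [DecidableEq I] [Fintype V] [DecidableEq V]
    (d : ℕ) (N : I → V → Finset V) (v : V) (hv : ∀ i, v ∉ N i v) (hN : ∀ i, #(N i v) ≤ d) :
    (#(blockedEvent d N v) : ℝ) ≤
      (1 - 1 / ((d : ℝ) + 1) * ((d : ℝ) / (d + 1)) ^ d) ^ Fintype.card I *
        Fintype.card (I → V → Fin (d + 1)) := by
  rw [blockedEvent, Fintype.card_piFinset, Nat.cast_prod, Fintype.card_fun (α := I), Nat.cast_pow,
    ← mul_pow, ← card_univ (α := I)]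
  refine (prod_le_prod (fun _ _ ↦ Nat.cast_nonneg _) fun i _ ↦ ?_).trans_eq (prod_const _)
  rw [card_compl, Nat.cast_sub (card_le_univ _), card_availableEvent d (N i v) v (hv i)]
  have hpow : ((d : ℝ) / (d + 1)) ^ d ≤ ((d : ℝ) / (d + 1)) ^ #(N i v) :=
    pow_le_pow_of_le_one (by positivity) (by rw [div_le_one (by positivity)]; linarith) (hN i)
  rw [sub_mul, one_mul]
  gcongr

lemma mem_blockedEvent {I V : Type*} [Fintype I] [DecidableEq I] [Fintype V] [DecidableEq V]
    {d : ℕ} {N : I → V → Finset V} {v : V} {f : I → V → Fin (d + 1)} :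
    f ∈ blockedEvent d N v ↔ ∀ i, f i v = 0 → ∃ u ∈ N i v, f i u = 0 := by
  simp [blockedEvent, availableEvent]

lemma mem_blockedEvent_congr {I V : Type*} [Fintype I] [DecidableEq I] [Fintype V] [DecidableEq V]
    {d : ℕ} {N : I → V → Finset V} {v : V} {f g : I → V → Fin (d + 1)}
    (hfg : ∀ i u, (u = v ∨ u ∈ N i v) → f i u = g i u) :
    f ∈ blockedEvent d N v ↔ g ∈ blockedEvent d N v := by
  rw [mem_blockedEvent, mem_blockedEvent]
  refine forall_congr' fun i ↦ ?_
  rw [hfg i v (Or.inl rfl)]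
  exact imp_congr_right fun _ ↦ exists_congr fun u ↦
    and_congr_right fun hu ↦ by rw [hfg i u (Or.inr hu)]

/-- The vertices `w` whose blocked event may share a coordinate with that of `v`: for some colour
they are neighbours of `v`, or have an out-neighbour in common with `v`. -/
def dependencySet {I V : Type*} [Fintype I] [Fintype V] [DecidableEq V] (N : I → V → Finset V)
    (v : V) : Finset V :=
  univ.biUnion fun i ↦ ({u | u ∈ N i v ∨ v ∈ N i u} : Finset V) ∪
    (N i v).biUnion fun u ↦ ({w | u ∈ N i w} : Finset V).erase v

lemma card_dependencySet_le {I V : Type*} [Fintype I] [Fintype V] [DecidableEq V] {d Δ : ℕ}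
    (N : I → V → Finset V) (hN : ∀ i v, #(N i v) ≤ d)
    (hΔ : ∀ i v, #{u | u ∈ N i v ∨ v ∈ N i u} ≤ Δ) (v : V) :
    #(dependencySet N v) ≤ Fintype.card I * (Δ + d * (Δ - 1)) := by
  rw [dependencySet, ← card_univ]
  refine card_biUnion_le_card_mul _ _ _ fun i _ ↦ (card_union_le _ _).trans ?_
  refine add_le_add (hΔ i v) ?_
  refine (card_biUnion_le_card_mul _ _ (Δ - 1) fun u hu ↦ ?_).trans
    (Nat.mul_le_mul_right _ (hN i v))
  rw [card_erase_of_mem (by simpa using hu)]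
  refine Nat.sub_le_sub_right ((card_le_card fun w hw ↦ ?_).trans (hΔ i u)) 1
  simp only [mem_filter, mem_univ, true_and] at hw ⊢
  exact Or.inr hw

lemma card_blockedEvent_inter_avoiding_le {I V : Type*} [Fintype I] [DecidableEq I] [Fintype V]
    [DecidableEq V] (d : ℕ) (N : I → V → Finset V) (v : V) (S : Finset V) (hvS : v ∉ S)
    (hS : Disjoint S (dependencySet N v)) :
    #(blockedEvent d N v ∩ avoiding (blockedEvent d N) S) * Fintype.card (I → V → Fin (d + 1)) ≤
      #(blockedEvent d N v) * #(avoiding (blockedEvent d N) S) := by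
  refine card_inter_mul_card_le (fun i u ↦ u = v ∨ u ∈ N i v) _ _
    (fun f g hfg ↦ (mem_blockedEvent_congr hfg).1) fun f g hfg hf ↦ ?_
  simp only [avoiding, mem_filter, mem_univ, true_and] at hf ⊢
  refine fun w hw ↦ mt (mem_blockedEvent_congr fun i u hu ↦ hfg i u fun huv ↦ ?_).2 (hf w hw)
  have hwv : w ≠ v := fun e ↦ hvS (e ▸ hw)
  refine disjoint_left.1 hS hw ?_
  simp only [dependencySet, mem_biUnion, mem_univ, true_and, mem_union, mem_filter, mem_erase]
  refine ⟨i, ?_⟩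
  rcases hu with rfl | hu
  · exact Or.inl (Or.inl (huv.resolve_left hwv))
  · rcases huv with rfl | huv
    · exact Or.inl (Or.inr hu)
    · exact Or.inr ⟨u, huv, hwv, hu⟩

/-- Cooperative colouring of digraphs: `N i v` is the set of out-neighbours of `v` in the `i`-th
digraph, with out-degrees at most `d` and total degrees at most `Δ`. Each vertex takes a colour that
is in its own list and in none of the lists of the corresponding out-neighbours. -/
theorem exists_coloring_of_local_condition {I V : Type*} [Fintype I] [Nonempty I] [DecidableEq I]
    [Fintype V] [DecidableEq V] {d Δ : ℕ} (hpos : 0 < Δ) (N : I → V → Finset V)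
    (hv : ∀ i v, v ∉ N i v) (hN : ∀ i v, #(N i v) ≤ d)
    (hΔ : ∀ i v, #{u | u ∈ N i v ∨ v ∈ N i u} ≤ Δ)
    (hloc : (1 - 1 / ((d : ℝ) + 1) * ((d : ℝ) / (d + 1)) ^ d) ^ Fintype.card I ≤
      1 / (((Fintype.card I * (Δ + d * (Δ - 1)) : ℕ) : ℝ) + 1) *
        (1 - 1 / (((Fintype.card I * (Δ + d * (Δ - 1)) : ℕ) : ℝ) + 1)) ^
          (Fintype.card I * (Δ + d * (Δ - 1)))) :
    ∃ c : V → I, ∀ v, ∀ u ∈ N (c v) v, c u ≠ c v := by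
  set M := Fintype.card I * (Δ + d * (Δ - 1)) with hM
  have hMpos : (0 : ℝ) < M := by
    have : 0 < M := Nat.mul_pos Fintype.card_pos (by omega)
    exact_mod_cast this
  obtain ⟨f, hf⟩ := exists_forall_notMem_of_local (blockedEvent d N) (dependencySet N) M
    (1 / ((M : ℝ) + 1)) (by positivity) (by rw [div_lt_one (by positivity)]; linarith)
    (card_dependencySet_le N hN hΔ) (fun v S hvS hS ↦ by
      have h1 : (#(blockedEvent d N v ∩ avoiding (blockedEvent d N) S) : ℝ) *
          Fintype.card (I → V → Fin (d + 1)) ≤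
            #(blockedEvent d N v) * #(avoiding (blockedEvent d N) S) := by
        exact_mod_cast card_blockedEvent_inter_avoiding_le d N v S hvS hS
      have h2 := (card_blockedEvent_le d N v (fun i ↦ hv i v) fun i ↦ hN i v).trans
        (mul_le_mul_of_nonneg_right hloc (Nat.cast_nonneg _))
      have hΩ : (0 : ℝ) < Fintype.card (I → V → Fin (d + 1)) := by
        exact_mod_cast Fintype.card_pos
      refine le_of_mul_le_mul_right (h1.trans ?_) hΩ
      exact (mul_le_mul_of_nonneg_right h2 (Nat.cast_nonneg _)).trans_eq (by ring))
  simp only [mem_blockedEvent, not_forall, not_exists, not_and, exists_prop] at hf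
  choose c hc0 hc using hf
  refine ⟨c, fun v u hu e ↦ hc v u hu ?_⟩
  rw [← e]
  exact hc0 u

/-! ### The numerical estimate -/

section Estimate

open Real

lemma exp_neg_one_le_one_sub_inv_pow (N : ℕ) :
    exp (-1) ≤ (1 - 1 / ((N : ℝ) + 1)) ^ N := by
  rcases Nat.eq_zero_or_pos N with rfl | hN
  · simp
  have hN' : (0 : ℝ) < N := by exact_mod_cast hN
  have h1 : 1 - 1 / ((N : ℝ) + 1) = (1 / (N : ℝ) + 1)⁻¹ := by field_simp; ring
  rw [h1, inv_pow, exp_neg]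
  have h2 : (1 / (N : ℝ) + 1) ^ N ≤ exp 1 := by
    calc (1 / (N : ℝ) + 1) ^ N ≤ exp (1 / N) ^ N := by gcongr; exact add_one_le_exp _
      _ = exp 1 := by rw [← exp_nat_mul]; congr 1; field_simp
  exact inv_anti₀ (by positivity) h2

/-- The tangent line of the logarithm at `c`. -/
lemma log_le_div_add_log_sub_one {x c : ℝ} (hx : 0 < x) (hc : 0 < c) :
    log x ≤ x / c + log c - 1 := by
  have := log_le_sub_one_of_pos (div_pos hx hc)
  rw [log_div hx.ne' hc.ne'] at this
  linarith

lemma exp_neg_one_div_le (d : ℕ) :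
    exp (-1) / ((d : ℝ) + 1) ≤ 1 / ((d : ℝ) + 1) * ((d : ℝ) / (d + 1)) ^ d := by
  have h := exp_neg_one_le_one_sub_inv_pow d
  have h1 : 1 - 1 / ((d : ℝ) + 1) = (d : ℝ) / (d + 1) := by field_simp; ring
  rw [h1] at h
  rw [div_eq_mul_inv, mul_comm, one_div]
  gcongr

lemma add_one_mul_pow_le (k : ℕ) (hk : 13 ≤ k) :
    exp 1 * ((k : ℝ) + 1) * (3 / 4) ^ k ≤ 1 := by
  induction k, hk using Nat.le_induction with
  | base => have := exp_one_lt_d9; norm_num at this ⊢; linarith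
  | succ k hk ih =>
    have hk' : (13 : ℝ) ≤ k := by exact_mod_cast hk
    refine le_trans ?_ ih
    rw [pow_succ]
    push_cast
    have : 0 < exp 1 * (3 / 4 : ℝ) ^ k := by positivity
    nlinarith

/-- Passage to logarithms in the condition `e * M * q ^ k ≤ 1`. -/
lemma exp_mul_mul_pow_le_one {M a q : ℝ} {k : ℕ} (hM : 0 < M) (hq0 : 0 ≤ q) (hq : q ≤ exp (-a))
    (h : 1 + log M ≤ k * a) : exp 1 * M * q ^ k ≤ 1 := by
  have h1 : q ^ k ≤ exp (-(k * a)) := by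
    calc q ^ k ≤ exp (-a) ^ k := by gcongr
      _ = exp (-(k * a)) := by rw [← exp_nat_mul]; ring_nf
  calc exp 1 * M * q ^ k ≤ exp 1 * exp (log M) * exp (-(k * a)) := by
        rw [exp_log hM]; gcongr
    _ = exp (1 + log M - k * a) := by rw [← exp_add, ← exp_add]; ring_nf
    _ ≤ 1 := exp_le_one_iff.2 (by linarith)

lemma local_condition_one (k Δ : ℕ) (hΔ : 1 ≤ Δ)
    (hk : 13 * (1 + log (Δ : ℝ)) ≤ k) :
    exp 1 * ((k : ℝ) * (2 * Δ - 1) + 1) * (3 / 4) ^ k ≤ 1 := by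
  have hΔ' : (1 : ℝ) ≤ Δ := by exact_mod_cast hΔ
  rcases hΔ.eq_or_lt with rfl | h2
  · have : (13 : ℝ) ≤ k := by simpa using hk
    have := add_one_mul_pow_le k (by exact_mod_cast this)
    norm_num at this ⊢
    linarith
  have h2' : (2 : ℝ) ≤ Δ := by exact_mod_cast h2
  have hl2 : 0.69 < log 2 := by linarith [log_two_gt_d9]
  have hlΔ : log 2 ≤ log Δ := log_le_log (by norm_num) h2'
  have hk0 : (21 : ℝ) ≤ k := by linarith
  have hM : (k : ℝ) * (2 * Δ - 1) + 1 ≤ k * (2 * Δ) := by nlinarith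
  refine (mul_le_mul_of_nonneg_right (mul_le_mul_of_nonneg_left hM (exp_pos 1).le)
    (by positivity)).trans (?_ : exp 1 * ((k : ℝ) * (2 * Δ)) * (3 / 4) ^ k ≤ 1)
  have hq : (3 / 4 : ℝ) ≤ exp (-0.26) := by
    calc (3 / 4 : ℝ) ≤ (-0.13 + 1) ^ 2 := by norm_num
      _ ≤ exp (-0.13) ^ 2 := by gcongr; exact add_one_le_exp _
      _ = exp (-0.26) := by rw [← exp_nat_mul]; norm_num
  refine exp_mul_mul_pow_le_one (a := 0.26) (by positivity) (by norm_num) hq ?_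
  rw [log_mul (by positivity) (by positivity), log_mul (by positivity) (by positivity)]
  have h16 : log (16 : ℝ) = 4 * log 2 := by
    rw [show (16 : ℝ) = 2 ^ 4 by norm_num, log_pow]; norm_num
  have := log_le_div_add_log_sub_one (x := k) (c := 16) (by linarith) (by norm_num)
  have hu : log 2 < 0.694 := by linarith [log_two_lt_d9]
  nlinarith

/-- The probability that all `k` colours are unavailable satisfies the hypothesis of the local lemma
with `k (Δ + d (Δ - 1))` dependencies. -/
theorem pow_le_local_bound {k d Δ : ℕ} (hd : 1 ≤ d) (hdΔ : d ≤ Δ)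
    (hk : 13 * (1 + (d : ℝ) * log ((d : ℝ) * (Δ : ℝ))) ≤ (k : ℝ)) :
    (1 - 1 / ((d : ℝ) + 1) * ((d : ℝ) / (d + 1)) ^ d) ^ k ≤
      1 / (((k * (Δ + d * (Δ - 1)) : ℕ) : ℝ) + 1) *
        (1 - 1 / (((k * (Δ + d * (Δ - 1)) : ℕ) : ℝ) + 1)) ^ (k * (Δ + d * (Δ - 1))) := by
  set N := k * (Δ + d * (Δ - 1)) with hN
  set q := 1 - 1 / ((d : ℝ) + 1) * ((d : ℝ) / (d + 1)) ^ d with hqdef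
  have hd' : (1 : ℝ) ≤ d := by exact_mod_cast hd
  have hdΔ' : (d : ℝ) ≤ Δ := by exact_mod_cast hdΔ
  have hΔ' : (1 : ℝ) ≤ Δ := hd'.trans hdΔ'
  have hN' : (N : ℝ) = k * (Δ + d * (Δ - 1)) := by
    rw [hN]; push_cast [Nat.cast_sub (hd.trans hdΔ)]; ring
  have hlog : 0 ≤ log ((d : ℝ) * Δ) := log_nonneg (by nlinarith)
  have hk13 : (13 : ℝ) ≤ k := by nlinarith [mul_nonneg (zero_le_one.trans hd') hlog]
  -- It is enough to prove the usual form `e (N + 1) q ^ k ≤ 1` of the condition.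
  suffices H : exp 1 * ((N : ℝ) + 1) * q ^ k ≤ 1 by
    have h1 := exp_neg_one_le_one_sub_inv_pow N
    have h2 : q ^ k ≤ 1 / ((N : ℝ) + 1) * exp (-1) := by
      rw [exp_neg, one_div, ← mul_inv, ← one_div, le_div_iff₀ (by positivity)]
      linarith
    exact h2.trans (by gcongr)
  rcases hd.eq_or_lt with rfl | hd2
  · have hq : q = 3 / 4 := by rw [hqdef]; norm_num
    rw [hq, hN']
    have := local_condition_one k Δ (by omega) (by simpa using hk)
    convert this using 4
    push_cast; ring
  have hd2' : (2 : ℝ) ≤ d := by exact_mod_cast hd2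
  have hM : (N : ℝ) + 1 ≤ k * ((d + 1) * Δ) := by rw [hN']; nlinarith
  have hq0 : 0 ≤ q := by
    have : ((d : ℝ) / (d + 1)) ^ d ≤ 1 :=
      pow_le_one₀ (by positivity) (by rw [div_le_one (by positivity)]; linarith)
    have h1 : 1 / ((d : ℝ) + 1) ≤ 1 := by rw [div_le_one (by positivity)]; linarith
    have := mul_le_one₀ h1 (by positivity) this
    rw [hqdef]; linarith
  refine (mul_le_mul_of_nonneg_right (mul_le_mul_of_nonneg_left hM (exp_pos 1).le)
    (by positivity)).trans (?_ : exp 1 * ((k : ℝ) * ((d + 1) * Δ)) * q ^ k ≤ 1)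
  have hl2 : 0.69 < log 2 := by linarith [log_two_gt_d9]
  have hu2 : log 2 < 0.694 := by linarith [log_two_lt_d9]
  have hlogd : log ((d : ℝ) * Δ) = log d + log Δ := log_mul (by positivity) (by positivity)
  have hlogdΔ : log (d : ℝ) ≤ log Δ := log_le_log (by positivity) hdΔ'
  have hl2d : log 2 ≤ log d := log_le_log (by norm_num) hd2'
  rcases Nat.eq_or_lt_of_le hd2 with rfl | hd3
  · -- For `d = 2` the exact value `4 / 27` is needed in place of `1 / (3 e)`.
    have hq : q ≤ exp (-(4 / 27)) := by
      refine le_trans (le_of_eq ?_) (add_one_le_exp _)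
      rw [hqdef]; norm_num
    refine exp_mul_mul_pow_le_one (by positivity) hq0 hq ?_
    rw [log_mul (by positivity) (by positivity), log_mul (by positivity) (by positivity)]
    have h64 : log (64 : ℝ) = 6 * log 2 := by
      rw [show (64 : ℝ) = 2 ^ 6 by norm_num, log_pow]; norm_num
    have h3 : log ((2 : ℕ) + 1 : ℝ) ≤ 1.14 := by
      have h := log_le_div_add_log_sub_one (x := 3) (c := 4) (by norm_num) (by norm_num)
      have h4 : log (4 : ℝ) = 2 * log 2 := by
        rw [show (4 : ℝ) = 2 ^ 2 by norm_num, log_pow]; norm_num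
      norm_num at h ⊢
      linarith
    have := log_le_div_add_log_sub_one (x := k) (c := 64) (by linarith) (by norm_num)
    push_cast at *
    nlinarith
  have hd3' : (3 : ℝ) ≤ d := by exact_mod_cast hd3
  have hq : q ≤ exp (-(exp (-1) / ((d : ℝ) + 1))) := by
    refine le_trans ?_ (add_one_le_exp _)
    have := exp_neg_one_div_le d
    rw [hqdef]; linarith
  refine exp_mul_mul_pow_le_one (by positivity) hq0 hq ?_
  rw [log_mul (by positivity) (by positivity), log_mul (by positivity) (by positivity)]
  have hlog8 : log (8 * (exp 1 * ((d : ℝ) + 1))) = 3 * log 2 + 1 + log (d + 1) := by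
    rw [log_mul (by norm_num) (by positivity), log_mul (by positivity) (by positivity), log_exp,
      show (8 : ℝ) = 2 ^ 3 by norm_num, log_pow]
    push_cast; ring
  have htan := log_le_div_add_log_sub_one (x := k) (c := 8 * (exp 1 * ((d : ℝ) + 1)))
    (by linarith) (by positivity)
  have hlogd1 : log ((d : ℝ) + 1) ≤ log d + 1 / 3 := by
    have h := log_le_div_add_log_sub_one (x := (d : ℝ) + 1) (c := d) (by positivity) (by positivity)
    have : ((d : ℝ) + 1) / d ≤ 4 / 3 := by rw [div_le_iff₀ (by positivity)]; linarith
    linarith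
  have h3 : 1.04 ≤ log (d : ℝ) := by
    have h := log_le_div_add_log_sub_one (x := 8) (c := 9) (by norm_num) (by norm_num)
    have h8 : log (8 : ℝ) = 3 * log 2 := by
      rw [show (8 : ℝ) = 2 ^ 3 by norm_num, log_pow]; norm_num
    have h9 : log (9 : ℝ) = 2 * log 3 := by
      rw [show (9 : ℝ) = 3 ^ 2 by norm_num, log_pow]; norm_num
    have : log (3 : ℝ) ≤ log d := log_le_log (by norm_num) hd3'
    linarith
  have hdiv : (k : ℝ) / (8 * (exp 1 * ((d : ℝ) + 1))) = k * (exp (-1) / (d + 1)) / 8 := by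
    rw [exp_neg]; field_simp
  have he : 0.36 ≤ exp (-1) := by linarith [exp_neg_one_gt_d9]
  have hmain : 13 * 0.36 * (3 / 4 * (log d + log Δ) + 1 / 4) ≤
      (k : ℝ) * (exp (-1) / (d + 1)) := by
    have hL : 2 ≤ log (d : ℝ) + log Δ := by linarith
    -- The difference of the two sides is at least `13 (d - 3) (L - 1) / 4`, with `L = log (d Δ)`.
    have h1 : 13 * ((d + 1) * (3 / 4 * (log d + log Δ) + 1 / 4)) ≤ (k : ℝ) := by
      rw [hlogd] at hk
      nlinarith [mul_nonneg (sub_nonneg.2 hd3') (sub_nonneg.2 (one_le_two.trans hL))]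
    have h2 : (k : ℝ) * (exp (-1) / (d + 1)) = k * exp (-1) / (d + 1) := by ring
    rw [h2, le_div_iff₀ (by positivity)]
    calc 13 * 0.36 * (3 / 4 * (log d + log Δ) + 1 / 4) * ((d : ℝ) + 1)
        = 13 * ((d + 1) * (3 / 4 * (log d + log Δ) + 1 / 4)) * 0.36 := by ring
      _ ≤ k * exp (-1) := by gcongr
  linarith

end Estimate

/-! ### Orientations of degenerate graphs and the cooperative colouring -/

lemma card_le_degree {α β : Type*} {G : Graph α β} {v : α} (T : Finset α)
    (hT : ∀ u ∈ T, G.Adj v u) : (#T : ℕ∞) ≤ CoopColoring.degree G v := by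
  rcases T.eq_empty_or_nonempty with rfl | ⟨u₀, hu₀⟩
  · simp
  have : Nonempty β := ⟨(hT u₀ hu₀).choose⟩
  choose! e he using hT
  rw [← Set.encard_coe_eq_coe_finsetCard]
  exact Set.encard_le_encard_of_injOn (f := e) (fun u hu ↦ ⟨u, he u hu⟩)
    fun u hu w hw huw ↦ (he u hu).right_unique (huw ▸ he w hw)

/-- A `d`-degenerate graph has an orientation with all out-degrees at most `d`; `N v` is the set of
out-neighbours of `v`. -/
lemma exists_orientation {α β : Type*} [DecidableEq α] (G : Graph α β) (d : ℕ)
    (hG : CoopColoring.IsDegenerate G d) (W : Finset α) (hW : (W : Set α) ⊆ V(G)) :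
    ∃ N : α → Finset α, (∀ v, N v ⊆ W) ∧ (∀ v, ∀ u ∈ N v, G.Adj v u) ∧ (∀ v, #(N v) ≤ d) ∧
      ∀ v ∈ W, ∀ u ∈ W, G.Adj v u → u ∈ N v ∨ v ∈ N u := by
  classical
  induction hn : #W using Nat.strong_induction_on generalizing W with
  | _ n ih =>
  subst hn
  rcases W.eq_empty_or_nonempty with rfl | hne
  · exact ⟨fun _ ↦ ∅, by simp⟩
  obtain ⟨v, hv, hvd⟩ := hG (G.induce W) (Graph.induce_le hW) (by simpa using hne)
  have hvW : v ∈ W := by simpa using hv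
  obtain ⟨N, hNW, hNadj, hNd, hN⟩ := ih _ (card_erase_lt_of_mem hvW) (W.erase v)
    ((coe_subset.2 (erase_subset _ _)).trans hW) rfl
  -- The vertex of degree at most `d` in `G[W]` sends all its edges out.
  refine ⟨Function.update N v {u ∈ W | G.Adj v u}, fun w ↦ ?_, fun w u hu ↦ ?_, fun w ↦ ?_,
    fun x hx y hy hxy ↦ ?_⟩
  · rcases eq_or_ne w v with rfl | hw
    · simp
    · simpa [hw] using (hNW w).trans (erase_subset _ _)
  · rcases eq_or_ne w v with rfl | hw
    · simp only [Function.update_self, mem_filter] at hu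
      exact hu.2
    · exact hNadj w u (by simpa [hw] using hu)
  · rcases eq_or_ne w v with rfl | hw
    · rw [Function.update_self]
      refine Nat.cast_le.1 ((card_le_degree (G := G.induce W) _ fun u hu ↦ ?_).trans hvd)
      obtain ⟨huW, e, he⟩ := mem_filter.1 hu
      exact ⟨e, he, hvW, huW⟩
    · simpa [hw] using hNd w
  · rcases eq_or_ne x v with rfl | hxv
    · exact Or.inl (by simp [hy, hxy])
    rcases eq_or_ne y v with rfl | hyv
    · exact Or.inr (by simp [hx, hxy.symm])
    simpa [hxv, hyv] using hN x (mem_erase.2 ⟨hxv, hx⟩) y (mem_erase.2 ⟨hyv, hy⟩) hxy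

lemma degree_le_of_maxDegree_le {α β : Type*} {G : Graph α β} {Δ : ℕ∞}
    (h : CoopColoring.maxDegree G ≤ Δ) {v : α} (hv : v ∈ V(G)) : CoopColoring.degree G v ≤ Δ :=
  (le_iSup₂ (f := fun v (_ : v ∈ V(G)) ↦ CoopColoring.degree G v) v hv).trans h

theorem corollary1p5 {α β : Type*} (V : Set α) (hV : V.Finite) (k d Δ : ℕ)
    (G : Fin k → Graph α β)
    (hvert : ∀ i, V(G i) = V)
    (hloop : ∀ i, (G i).Loopless)
    (hdeg : ∀ i, CoopColoring.IsDegenerate (G i) d)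
    (hmax : ∀ i, CoopColoring.maxDegree (G i) ≤ (Δ : ℕ∞))
    (hk : 13 * (1 + (d : ℝ) * Real.log ((d : ℝ) * (Δ : ℝ))) ≤ (k : ℝ)) :
    ∃ R : Fin k → Set α, CoopColoring.IsCooperativeColoring V G R := by
  classical
  have hlog : 0 ≤ (d : ℝ) * Real.log ((d : ℝ) * Δ) := by
    rw [← Nat.cast_mul]
    exact mul_nonneg (Nat.cast_nonneg _) (Real.log_natCast_nonneg _)
  have hk0 : 0 < k := by
    have : (0 : ℝ) < k := by linarith
    exact_mod_cast this
  have : Nonempty (Fin k) := ⟨⟨0, hk0⟩⟩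
  have := hV.fintype
  have hdegΔ : ∀ i, ∀ v : V, CoopColoring.degree (G i) v ≤ Δ := fun i v ↦
    degree_le_of_maxDegree_le (hmax i) (by rw [hvert]; exact v.2)
  have horient : ∀ i, ∃ N : V → Finset V, (∀ v, ∀ u ∈ N v, (G i).Adj v u) ∧ (∀ v, #(N v) ≤ d) ∧
      ∀ v u : V, (G i).Adj v u → u ∈ N v ∨ v ∈ N u := by
    intro i
    obtain ⟨N, -, hNadj, hNd, hN⟩ := exists_orientation (G i) d (hdeg i) V.toFinset
      (by simp [hvert])
    refine ⟨fun v ↦ (N v).subtype (· ∈ V), fun v u hu ↦ hNadj v u (by simpa using hu), fun v ↦ ?_,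
      fun v u hvu ↦ ?_⟩
    · rw [card_subtype]
      exact (card_filter_le _ _).trans (hNd v)
    · simpa using hN v (by simp) u (by simp) hvu
  choose N hNadj hNd hN using horient
  have hcard : ∀ i, ∀ v : V, ∀ T : Finset V, (∀ u ∈ T, (G i).Adj v u) → #T ≤ Δ := by
    intro i v T hT
    rw [← card_map (Function.Embedding.subtype (· ∈ V))]
    refine Nat.cast_le.1 ((card_le_degree _ fun u hu ↦ ?_).trans (hdegΔ i v))
    obtain ⟨w, hw, rfl⟩ := mem_map.1 hu
    exact hT w hw
  -- A colouring in which no vertex shares its colour with an out-neighbour gives the sets `R i`.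
  suffices H : ∃ c : V → Fin k, ∀ v, ∀ u ∈ N (c v) v, c u ≠ c v by
    obtain ⟨c, hc⟩ := H
    refine ⟨fun i ↦ (↑) '' (c ⁻¹' {i}), fun i ↦ ⟨?_, ?_⟩, ?_⟩
    · rw [hvert]
      exact Subtype.coe_image_subset _ _
    · rintro _ ⟨x, rfl, rfl⟩ _ ⟨y, hy, rfl⟩ hxy
      rcases hN _ x y hxy with h | h
      · exact hc x y h hy
      · exact hc y x (by rwa [show c y = c x from hy]) hy.symm
    · ext v
      simp
  rcases Nat.eq_zero_or_pos (min d Δ) with h0 | hpos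
  · -- There are no edges, as a degeneracy or maximum degree `0` allows no out-neighbours.
    refine ⟨fun _ ↦ Classical.arbitrary _, fun v u hu ↦ absurd hu ?_⟩
    have h1 : #(N (Classical.arbitrary (Fin k)) v) ≤ min d Δ :=
      le_min (hNd _ v) (hcard _ v _ (hNadj _ v))
    rw [h0, Nat.le_zero, card_eq_zero] at h1
    simp [h1]
  -- Out-degrees are also at most `Δ`, so `d` may be replaced with `min d Δ`.
  have hk' : 13 * (1 + ((min d Δ : ℕ) : ℝ) * Real.log (((min d Δ : ℕ) : ℝ) * (Δ : ℝ))) ≤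
      (k : ℝ) := by
    refine le_trans ?_ hk
    have h1 : (1 : ℝ) ≤ (min d Δ : ℕ) := by exact_mod_cast hpos
    have h2 : ((min d Δ : ℕ) : ℝ) ≤ d := by exact_mod_cast min_le_left d Δ
    have h3 : (1 : ℝ) ≤ Δ := by exact_mod_cast hpos.trans_le (min_le_right d Δ)
    have h4 : (1 : ℝ) ≤ ((min d Δ : ℕ) : ℝ) * Δ := by nlinarith
    have := Real.log_nonneg h4
    gcongr
  have hloc := pow_le_local_bound hpos (min_le_right d Δ) hk'
  refine exists_coloring_of_local_condition (d := min d Δ) (Δ := Δ)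
    (hpos.trans_le (min_le_right d Δ)) N (fun i v hv ↦ ?_)
    (fun i v ↦ le_min (hNd i v) (hcard i v _ (hNadj i v)))
    (fun i v ↦ hcard i v _ fun u hu ↦ ?_) (by simpa using hloc)
  · have := hloop i
    exact (G i).not_adj_self v (hNadj i v v hv)
  · rcases (mem_filter.1 hu).2 with h | h
    · exact hNadj i v u h
    · exact (hNadj i u v h).symm
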